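/- Let $F_2=\langle a,b\rangle$ be the free pro-$2$ group on two generators. For an integer $k\ge 1$ let $W_k=\langle \dot y_k\rangle\wr\langle \dot x_k\rangle\cong C_2\wr C_{2^k}$ be the wreath product of a cyclic group of order $2$ by a cyclic group of order $2^k$, with base group $B_k\cong C_2^{\,2^k}$. Let $R_k$ be the kernel of the continuous epimorphism $F_2\to W_k$ with $a\mapsto \dot x_k$, $b\mapsto \dot y_k$, let $Y_k$ be the preimage of $B_k$ in $F_2$, and set $$N_k=[R_k,Y_k]\,R_k^{\,2}\,\langle a^{2^k}\rangle^{F_2},\qquad G_k=F_2/N_k,$$ where $\langle a^{2^k}\rangle^{F_2}$ is the normal closure and $N_k$ is understood as a closed subgroup of $F_2$. Let $x_k$ be the image of $a$ in the finite $2$-group $G_k$. For a subgroup $H$ write $H^2=\langle h^2\mid h\in H\rangle$. Let $\gamma_1(G_k)=G_k$, $\gamma_{i+1}(G_k)=[\gamma_i(G_k),G_k]$ be the lower central series, and let the dimension subgroup (Jennings, Zassenhaus) series of $G_k$ at the prime $2$ be defined by $D_1(G_k)=G_k$ and $$D_i(G_k)=D_{\lceil i/2\rceil}(G_k)^2\prod_{1\le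 j<i}[D_j(G_k),D_{i-j}(G_k)]\qquad (i\ge 2).$$ Then for every $k\ge 1$ the dimension subgroup series of $G_k$ has length $2^{k+1}$, that is, $2^{k+1}$ is the least integer $\ell\geq 0$ with $D_{\ell+1}(G_k)=1$, and $$D_i(G_k)=\langle x_k^{\,2^{l(i)}}\rangle\,\gamma_{\lceil i/2\rceil}(G_k)^2\,\gamma_i(G_k)\qquad\text{for } 1\le i\le 2^{k+1},$$ where $l(i)=\lceil\log_2 i\rceil$. -/

import Mathlib

/-! ### Group-theoretic series -/

namespace GroupSeries

variable {Γ : Type*} [Group Γ]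

/-- `H ^ m`: the subgroup generated by all `m`-th powers of elements of `H`. -/
def powSubgroup (H : Subgroup Γ) (m : ℕ) : Subgroup Γ :=
  Subgroup.closure {g | ∃ h ∈ H, h ^ m = g}

/-- The lower central series `γ_1(Γ) = Γ`, `γ_{i+1}(Γ) = [γ_i(Γ), Γ]`, indexed from `1`
(Mathlib's series starts at index `0`). -/
def gamma (Γ : Type*) [Group Γ] (i : ℕ) : Subgroup Γ :=
  (⊤ : Subgroup Γ).lowerCentralSeries (i - 1)

/-- The (modular) dimension subgroup series, or Jennings, or Zassenhaus series at the prime `p`: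
`D_1(Γ) = Γ` and `D_i(Γ) = D_{⌈i/p⌉}(Γ)^p ∏_{1 ≤ j < i} [D_j(Γ), D_{i-j}(Γ)]` for `i ≥ 2`;
also `D_0(Γ) = Γ`. (For a finite group, all subgroups are closed.) -/
def dimensionSeries (p : ℕ) [hp : Fact p.Prime] (Γ : Type*) [Group Γ] : ℕ → Subgroup Γ
  | 0 => ⊤
  | 1 => ⊤
  | n + 2 =>
      powSubgroup (dimensionSeries p Γ ((n + 2) ⌈/⌉ p)) p ⊔
        ⨆ j : Set.Ico 1 (n + 2),
          ⁅dimensionSeries p Γ j.1, dimensionSeries p Γ (n + 2 - j.1)⁆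
termination_by i => i
decreasing_by
  · rw [Nat.ceilDiv_eq_add_pred_div, Nat.div_lt_iff_lt_mul hp.out.pos]
    have h2 := hp.out.two_le
    nlinarith [Nat.sub_le_iff_le_add.mpr (le_refl (n + 2 + p)), Nat.sub_lt
      (show 0 < n + 2 + p by omega) one_pos]
  · exact j.2.2
  · have h1 := j.2.1
    omega

/-- A descending series `S_1 ≥ S_2 ≥ ⋯` of subgroups has length `ℓ` if `ℓ` is the least number
with `S_{ℓ+1} = 1`, so that `S_1, …, S_ℓ` are exactly its non-trivial terms. -/
def HasLength (S : ℕ → Subgroup Γ) (l : ℕ) : Prop :=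
  IsLeast {n | S (n + 1) = ⊥} l

end GroupSeries

/-! ### The free pro-2 group on two generators -/

namespace FreePro2

/-- The normal subgroups of 2-power index of the free group of rank two. -/
def TwoPowerNormal : Type :=
  {N : Subgroup (FreeGroup (Fin 2)) // N.Normal ∧ ∃ n : ℕ, N.index = 2 ^ n}

instance (N : TwoPowerNormal) : N.1.Normal := N.2.1

/-- The finite 2-group quotients of the free group, with the discrete topology. -/
def FinQuot (N : TwoPowerNormal) : Type := FreeGroup (Fin 2) ⧸ N.1

instance (N : TwoPowerNormal) : Group (FinQuot N) :=
  inferInstanceAs (Group (FreeGroup (Fin 2) ⧸ N.1))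

instance (N : TwoPowerNormal) : TopologicalSpace (FinQuot N) := ⊥

instance (N : TwoPowerNormal) : DiscreteTopology (FinQuot N) := ⟨rfl⟩

/-- The projection of the free group onto one of its finite 2-group quotients. -/
def toFinQuot (N : TwoPowerNormal) : FreeGroup (Fin 2) →* FinQuot N := QuotientGroup.mk' N.1

/-- The transition map between two finite quotients. -/
def transition {N M : TwoPowerNormal} (h : N.1 ≤ M.1) : FinQuot N →* FinQuot M :=
  QuotientGroup.map N.1 M.1 (MonoidHom.id _) h

/-- The inverse limit of all finite 2-group quotients, inside the direct product with the product
topology. -/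
def limit : Subgroup (∀ N : TwoPowerNormal, FinQuot N) where
  carrier := {f | ∀ (N M : TwoPowerNormal) (h : N.1 ≤ M.1), transition h (f N) = f M}
  mul_mem' := fun {f g} hf hg N M h => by
    rw [Pi.mul_apply, map_mul, hf N M h, hg N M h, Pi.mul_apply]
  one_mem' := fun N M h => by rw [Pi.one_apply, map_one, Pi.one_apply]
  inv_mem' := fun {f} hf N M h => by rw [Pi.inv_apply, map_inv, hf N M h, Pi.inv_apply]

/-- The free pro-2 group `F_2` on two generators: the pro-2 completion of the free group. It is a
topological group with the subspace topology of the product topology. -/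
abbrev F : Type := ↥limit

/-- The canonical map from the free group to the free pro-2 group. -/
def ofFree : FreeGroup (Fin 2) →* F where
  toFun w := ⟨fun N => toFinQuot N w, fun _ _ _ => rfl⟩
  map_one' := rfl
  map_mul' _ _ := rfl

/-- The first free generator. -/
def a : F := ofFree (FreeGroup.of 0)

/-- The second free generator. -/
def b : F := ofFree (FreeGroup.of 1)

theorem ker_index {P : Type} [Group P] [Finite P] (hP : IsPGroup 2 P)
    (φ : FreeGroup (Fin 2) →* P) : ∃ n : ℕ, φ.ker.index = 2 ^ n := by
  rw [Subgroup.index_ker]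
  exact IsPGroup.iff_card.mp (hP.to_subgroup φ.range)

/-- The kernel of a homomorphism from the free group to a finite 2-group. -/
def kerTwoPower {P : Type} [Group P] [Finite P] (hP : IsPGroup 2 P)
    (φ : FreeGroup (Fin 2) →* P) : TwoPowerNormal :=
  ⟨φ.ker, inferInstance, ker_index hP φ⟩

/-- The continuous homomorphism from the free pro-2 group to a finite 2-group `P` that extends a
given homomorphism `φ` of the free group, through the quotient by the kernel of `φ`. -/
def lift {P : Type} [Group P] [Finite P] (hP : IsPGroup 2 P)
    (φ : FreeGroup (Fin 2) →* P) : F →* P :=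
  (QuotientGroup.kerLift φ).comp
    ((Pi.evalMonoidHom FinQuot (kerTwoPower hP φ)).comp limit.subtype)

theorem lift_ofFree {P : Type} [Group P] [Finite P] (hP : IsPGroup 2 P)
    (φ : FreeGroup (Fin 2) →* P) (w : FreeGroup (Fin 2)) : lift hP φ (ofFree w) = φ w := rfl

end FreePro2

/-! ### The groups `G_k` -/

namespace GroupG

open FreePro2 GroupSeries

/-- `W_k = ⟨ẏ⟩ ≀ ⟨ẋ⟩`, the wreath product of the cyclic group of order `2` by the cyclic group of
order `2 ^ k`. -/
abbrev W (k : ℕ) : Type := Multiplicative (ZMod 2) ≀ᵣ Multiplicative (ZMod (2 ^ k))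

/-- The generator `ẋ_k` of the top group. -/
def xDot (k : ℕ) : W k := RegularWreathProduct.inl (Multiplicative.ofAdd 1)

/-- The generator `ẏ_k`, in the coordinate at the identity of the base group. -/
def yDot (k : ℕ) : W k := ⟨Pi.mulSingle 1 (Multiplicative.ofAdd 1), 1⟩

/-- The base group `B_k`, the direct product of `2 ^ k` copies of the cyclic group of order `2`. -/
def B (k : ℕ) : Subgroup (W k) := RegularWreathProduct.rightHom.ker

instance (k : ℕ) : NeZero (2 ^ k) := ⟨pow_ne_zero k two_ne_zero⟩

instance (k : ℕ) : Finite (Multiplicative (ZMod (2 ^ k))) :=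
  inferInstanceAs (Finite (ZMod (2 ^ k)))

theorem isPGroup_W (k : ℕ) : IsPGroup 2 (W k) := by
  apply IsPGroup.of_card (n := 2 ^ k + k)
  rw [RegularWreathProduct.card, pow_add]
  simp only [Nat.card_eq_of_bijective _ Multiplicative.toAdd.bijective, Nat.card_zmod]

/-- The epimorphism from `F_2` onto `W_k` with `a ↦ ẋ_k` and `b ↦ ẏ_k`. -/
def toW (k : ℕ) : F →* W k :=
  FreePro2.lift (isPGroup_W k) (FreeGroup.lift ![xDot k, yDot k])

/-- `R_k`, the closed normal subgroup of `F_2` with `F_2 / R_k ≅ W_k`. -/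
def R (k : ℕ) : Subgroup F := (toW k).ker

/-- `Y_k`, the pre-image in `F_2` of the base group `B_k`. -/
def Y (k : ℕ) : Subgroup F := (B k).comap (toW k)

/-- `N_k = [R_k, Y_k] R_k ^ 2 ⟨a ^ (2 ^ k)⟩^{F_2}`, as a closed subgroup of `F_2`. -/
def N (k : ℕ) : Subgroup F :=
  (⁅R k, Y k⁆ ⊔ powSubgroup (R k) 2 ⊔
    Subgroup.normalClosure {a ^ (2 ^ k)}).topologicalClosure

theorem powSubgroup_normal {Γ : Type*} [Group Γ] (H : Subgroup Γ) [hH : H.Normal] (m : ℕ) :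
    (powSubgroup H m).Normal := by
  have h : powSubgroup H m = Subgroup.normalClosure {g | ∃ h ∈ H, h ^ m = g} := by
    apply le_antisymm Subgroup.closure_le_normalClosure
    apply Subgroup.closure_mono
    intro g hg
    obtain ⟨_, ⟨h, hh, rfl⟩, hc⟩ := Group.mem_conjugatesOfSet_iff.mp hg
    obtain ⟨c, rfl⟩ := isConj_iff.mp hc
    exact ⟨c * h * c⁻¹, hH.conj_mem h hh c, conj_pow⟩
  rw [h]
  infer_instance

instance (k : ℕ) : (N k).Normal := by
  have h1 : (R k).Normal := MonoidHom.normal_ker _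
  have h2 : (B k).Normal := MonoidHom.normal_ker _
  have h3 : (Y k).Normal := Subgroup.Normal.comap h2 _
  have h4 := powSubgroup_normal (R k) 2
  exact Subgroup.is_normal_topologicalClosure _

/-- `G_k = F_2 / N_k`. -/
abbrev G (k : ℕ) : Type := F ⧸ N k

/-- `x_k`, the image of `a` in `G_k`. -/
def x (k : ℕ) : G k := QuotientGroup.mk a

end GroupG

/-!
Put `q = 2 ^ k`, and let `H` and `Z` be the images of `Y_k` and `R_k` in `Γ = G_k`. Then `H` is normal
with `Γ = ⟨x⟩ H`, and `Z` has exponent two, is central in `H`, and contains all squares and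
commutators of elements of `H`; also `x ^ q = 1` (`GroupG.isCyclicExtension`). Some care is needed to
see that `x` and `y` generate `Γ` abstractly and not only topologically: they generate a finite
subgroup by Schreier's lemma, and a finite dense subgroup is everything (`GroupG.closure_eq_top`).

*The formula.* The product on the right-hand side lies in `D_i` in any group. For the converse, give
the elements of `γ_i ∩ H` weight `i`, let `quad H m ≤ Z` be generated by the squares of elements of
weight at least `m / 2` and the commutators of elements of weights adding up to at least `m`, and put
`T_i = ⟨x ^ (2 ^ l(i))⟩ (γ_i ∩ H) (quad H i)`. Write `∂ u = [x, u]`. Since squares and commutators of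
`H` are central involutions, commutation with `x` raises the weight on `quad` by one, and
`[x ^ (2 ^ l), u]` agrees with `∂ ^ (2 ^ l) u` up to `quad` of weight `2 ^ l` more than that of `u`
(`IsCyclicExtension.exists_commutator_pow_eq`), the group version of
`t ^ (2 ^ l) - 1 = (t - 1) ^ (2 ^ l)` modulo `2`. It follows that `[T_i, T_j] ≤ T_{i + j}` and that
squares of elements of `T_i` lie in `T_{2 i}`, whence `D_i ≤ T_i`, and `T_i` lies in the product by
`[γ_a, γ_b] ≤ γ_{a + b}`.

*The length is at most `2 q`.* Every element of weight `j + 1` is `∂ ^ j u` for some `u ∈ H`, modulo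
`quad H (j + 1)`. As `x ^ q = 1`, the element `∂ ^ q u` lies in `quad H (q + 1)`. So the elements of
weight above `q` lie in `quad`, and thus in `Z`. It follows that `quad H (2 q + 1)` is trivial, since
one of two weights with sum at least `2 q + 1` exceeds `q`, and then `T_{2 q + 1} = 1`.

*The length is at least `2 q`.* The element `∂ ^ (q - 1) y` of `γ_q` has its square in `D_{2 q}`. In
the quotient `C_4 ≀ C_q` of `Γ`, it is given by the coefficients of `(t - 1) ^ (q - 1)` modulo `4`; the
constant one is odd, so the square is not trivial (`GroupG.sq_iterate_commutator_yV_ne_one`).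
-/

/-! ### General facts on the lower central and the dimension subgroup series -/

namespace GroupSeries

open scoped commutatorElement

variable {Γ : Type*} [Group Γ]

theorem gamma_succ {i : ℕ} (hi : 1 ≤ i) : gamma Γ (i + 1) = ⁅gamma Γ i, ⊤⁆ := by
  obtain ⟨n, rfl⟩ := Nat.exists_eq_add_of_le' hi
  rfl

theorem gamma_antitone : Antitone (gamma Γ) := fun _ _ h =>
  Subgroup.lowerCentralSeries_antitone _ (Nat.sub_le_sub_right h 1)

instance gamma_normal (i : ℕ) : (gamma Γ i).Normal := by
  unfold gamma; infer_instance

/-- The three subgroups lemma relative to a normal subgroup. -/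
theorem commutator_commutator_le_of_rotate {A B C K : Subgroup Γ} [K.Normal]
    (h1 : ⁅⁅B, C⁆, A⁆ ≤ K) (h2 : ⁅⁅C, A⁆, B⁆ ≤ K) : ⁅⁅A, B⁆, C⁆ ≤ K := by
  have key : ∀ S : Subgroup Γ, S ≤ K ↔ S.map (QuotientGroup.mk' K) = ⊥ := fun S => by
    rw [Subgroup.map_eq_bot_iff, QuotientGroup.ker_mk']
  rw [key] at h1 h2 ⊢
  simp only [Subgroup.map_commutator] at h1 h2 ⊢
  exact Subgroup.commutator_commutator_eq_bot_of_rotate h1 h2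

theorem gamma_commutator_le {i j : ℕ} (hi : 1 ≤ i) (hj : 1 ≤ j) :
    ⁅gamma Γ i, gamma Γ j⁆ ≤ gamma Γ (i + j) := by
  induction j, hj using Nat.le_induction generalizing i with
  | base => exact (gamma_succ hi).ge
  | succ j hj ih =>
    rw [gamma_succ hj, Subgroup.commutator_comm]
    apply commutator_commutator_le_of_rotate
    · rw [Subgroup.commutator_comm ⊤, ← gamma_succ hi]
      exact (ih (by omega)).trans (le_of_eq (by congr 1; omega))
    · rw [show i + (j + 1) = (i + j) + 1 by omega, gamma_succ (i := i + j) (by omega)]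
      exact Subgroup.commutator_mono (ih hi) le_rfl

theorem sq_mem_powSubgroup {H : Subgroup Γ} {g : Γ} (hg : g ∈ H) : g ^ 2 ∈ powSubgroup H 2 :=
  Subgroup.subset_closure ⟨g, hg, rfl⟩

theorem powSubgroup_mono {H K : Subgroup Γ} (h : H ≤ K) (m : ℕ) :
    powSubgroup H m ≤ powSubgroup K m :=
  Subgroup.closure_mono fun _ ⟨u, hu, hg⟩ => ⟨u, h hu, hg⟩

theorem ceilDiv_two (n : ℕ) : n ⌈/⌉ 2 = (n + 1) / 2 := by
  rw [Nat.ceilDiv_eq_add_pred_div]; rfl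

theorem powSubgroup_le_dimensionSeries {n : ℕ} (hn : 2 ≤ n) :
    powSubgroup (dimensionSeries 2 Γ (n ⌈/⌉ 2)) 2 ≤ dimensionSeries 2 Γ n := by
  obtain ⟨m, rfl⟩ := Nat.exists_eq_add_of_le' hn
  conv_rhs => rw [dimensionSeries]
  exact le_sup_left

theorem commutator_le_dimensionSeries {i j : ℕ} (hi : 1 ≤ i) (hj : 1 ≤ j) :
    ⁅dimensionSeries 2 Γ i, dimensionSeries 2 Γ j⁆ ≤ dimensionSeries 2 Γ (i + j) := by
  obtain ⟨m, hm⟩ := Nat.exists_eq_add_of_le' (show 2 ≤ i + j by omega)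
  rw [hm]
  conv_rhs => rw [dimensionSeries]
  refine le_trans ?_ le_sup_right
  refine le_trans (le_of_eq ?_) (le_iSup _ (⟨i, hi, by omega⟩ : Set.Ico 1 (m + 2)))
  simp only
  congr 2
  omega

/-- The dimension subgroup series at `2` is the least series that starts with the whole group, is
strongly central, and doubles the index under squaring. -/
theorem dimensionSeries_le {T : ℕ → Subgroup Γ} (h1 : T 1 = ⊤)
    (hsq : ∀ n, 2 ≤ n → ∀ g ∈ T (n ⌈/⌉ 2), g ^ 2 ∈ T n)
    (hcomm : ∀ i j, 1 ≤ i → 1 ≤ j → ⁅T i, T j⁆ ≤ T (i + j)) {i : ℕ} (hi : 1 ≤ i) :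
    dimensionSeries 2 Γ i ≤ T i := by
  induction i using Nat.strong_induction_on with
  | _ i ih =>
    obtain rfl | hi' := hi.eq_or_lt
    · rw [h1]; exact le_top
    obtain ⟨m, rfl⟩ := Nat.exists_eq_add_of_le' hi'
    conv_lhs => rw [dimensionSeries]
    refine sup_le ?_ (iSup_le ?_)
    · refine (Subgroup.closure_le _).2 ?_
      rintro _ ⟨g, hg, rfl⟩
      exact hsq _ hi' _ (ih _ (by rw [ceilDiv_two]; omega) (by rw [ceilDiv_two]; omega) hg)
    · rintro ⟨j, hj1, hj2⟩
      simp only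
      refine (Subgroup.commutator_mono (ih j hj2 hj1) (ih _ (by omega) (by omega))).trans ?_
      refine (hcomm _ _ hj1 (by omega)).trans (le_of_eq ?_)
      congr 1
      omega

theorem dimensionSeries_succ_le (n : ℕ) : dimensionSeries 2 Γ (n + 1) ≤ dimensionSeries 2 Γ n := by
  induction n using Nat.strong_induction_on with
  | _ n ih =>
    match n with
    | 0 => rw [dimensionSeries.eq_1]; exact le_top
    | 1 => rw [dimensionSeries.eq_2]; exact le_top
    | n + 2 =>
      rw [show n + 2 + 1 = (n + 1) + 2 from rfl]
      conv_lhs => rw [dimensionSeries]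
      refine sup_le ?_ (iSup_le ?_)
      · refine le_trans (powSubgroup_mono ?_ 2) (powSubgroup_le_dimensionSeries (by omega))
        rw [ceilDiv_two, ceilDiv_two]
        rcases Nat.even_or_odd' n with ⟨m, rfl | rfl⟩
        · rw [show (2 * m + 1 + 2 + 1) / 2 = m + 2 by omega,
            show (2 * m + 2 + 1) / 2 = m + 1 by omega]
          exact ih _ (by omega)
        · rw [show (2 * m + 1 + 1 + 2 + 1) / 2 = m + 2 by omega,
            show (2 * m + 1 + 2 + 1) / 2 = m + 2 by omega]
      · rintro ⟨j, hj1, hj2⟩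
        obtain rfl | hj := eq_or_lt_of_le hj1
        · refine le_trans (Subgroup.commutator_mono le_rfl ?_)
            (commutator_le_dimensionSeries (i := 1) (j := n + 1) le_rfl (by omega)
              |>.trans (le_of_eq (by congr 1; omega)))
          exact ih (n + 1) (by omega)
        · obtain ⟨t, rfl⟩ := Nat.exists_eq_add_of_le' hj
          refine le_trans (Subgroup.commutator_mono (ih (t + 1) (by simp at hj2; omega)) le_rfl)
            (commutator_le_dimensionSeries (by omega) (by simp at hj2 ⊢; omega)
              |>.trans (le_of_eq (by congr 1; simp at hj2 ⊢; omega)))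

theorem dimensionSeries_antitone : Antitone (dimensionSeries 2 Γ) :=
  antitone_nat_of_succ_le dimensionSeries_succ_le

theorem gamma_le_dimensionSeries {i : ℕ} (hi : 1 ≤ i) : gamma Γ i ≤ dimensionSeries 2 Γ i := by
  induction i, hi using Nat.le_induction with
  | base => rw [dimensionSeries.eq_2]; exact le_top
  | succ i hi ih =>
    rw [gamma_succ hi]
    refine (Subgroup.commutator_mono ih ?_).trans (commutator_le_dimensionSeries hi le_rfl)
    rw [dimensionSeries.eq_2]

theorem pow_two_pow_mem_dimensionSeries (g : Γ) (l : ℕ) :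
    g ^ 2 ^ l ∈ dimensionSeries 2 Γ (2 ^ l) := by
  induction l with
  | zero => rw [pow_zero, dimensionSeries.eq_2]; trivial
  | succ l ih =>
    have h2 : 2 ≤ 2 ^ (l + 1) := by rw [pow_succ]; have := Nat.one_le_two_pow (n := l); omega
    apply powSubgroup_le_dimensionSeries h2
    rw [pow_succ, pow_mul]
    apply sq_mem_powSubgroup
    rwa [ceilDiv_two, show (2 ^ l * 2 + 1) / 2 = 2 ^ l by omega]

theorem clog_two_ceilDiv {n : ℕ} (hn : 2 ≤ n) : Nat.clog 2 n = Nat.clog 2 (n ⌈/⌉ 2) + 1 := by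
  rw [Nat.clog_of_two_le one_lt_two hn, ceilDiv_two]; rfl

/-- The right-hand side of the formula for `D_i` always lies in `D_i`. -/
theorem sup_le_dimensionSeries (g : Γ) {i : ℕ} (hi : 1 ≤ i) :
    Subgroup.zpowers (g ^ 2 ^ Nat.clog 2 i) ⊔ powSubgroup (gamma Γ (i ⌈/⌉ 2)) 2 ⊔ gamma Γ i ≤
      dimensionSeries 2 Γ i := by
  refine sup_le (sup_le ?_ ?_) (gamma_le_dimensionSeries hi)
  · rw [Subgroup.zpowers_le]
    exact dimensionSeries_antitone (Nat.le_pow_clog one_lt_two i)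
      (pow_two_pow_mem_dimensionSeries g _)
  · obtain rfl | hi' := hi.eq_or_lt
    · rw [dimensionSeries.eq_2]; exact le_top
    · exact (powSubgroup_mono (gamma_le_dimensionSeries (by rw [ceilDiv_two]; omega)) 2).trans
        (powSubgroup_le_dimensionSeries hi')

/-! ### Commutator calculus in an extension of a class-two group by a cyclic group -/

/-- `Γ = ⟨x⟩ H` with `H` normal, and `Z ≤ H` is a subgroup of exponent two, central in `H`, that
contains all squares and commutators of elements of `H`. -/
structure IsCyclicExtension (x : Γ) (H Z : Subgroup Γ) : Prop where
  normal : H.Normal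
  le : Z ≤ H
  sup_eq : Subgroup.zpowers x ⊔ H = ⊤
  sq_mem : ∀ h ∈ H, h ^ 2 ∈ Z
  commutator_mem : ∀ g ∈ H, ∀ h ∈ H, ⁅g, h⁆ ∈ Z
  comm : ∀ z ∈ Z, ∀ h ∈ H, z * h = h * z
  sq_eq_one : ∀ z ∈ Z, z ^ 2 = 1

/-- The terms of the lower central series, intersected with `H`; only the first one can change if
the quotient by `H` is cyclic. -/
def layer (H : Subgroup Γ) (i : ℕ) : Subgroup Γ := gamma Γ i ⊓ H

/-- The subgroup generated by the squares `u ^ 2` of elements of `H` of weight `a` with `2 a ≥ m`,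
and the commutators of elements of `H` of weights `a` and `b` with `a + b ≥ m`. -/
def quad (H : Subgroup Γ) (m : ℕ) : Subgroup Γ :=
  Subgroup.closure
    ({g | ∃ a, 1 ≤ a ∧ m ≤ 2 * a ∧ ∃ u ∈ layer H a, u ^ 2 = g} ∪
      {g | ∃ a b, 1 ≤ a ∧ 1 ≤ b ∧ m ≤ a + b ∧ ∃ u ∈ layer H a, ∃ v ∈ layer H b, ⁅u, v⁆ = g})

theorem sq_mem_quad {H : Subgroup Γ} {m a : ℕ} (ha : 1 ≤ a) (hm : m ≤ 2 * a) {u : Γ}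
    (hu : u ∈ layer H a) : u ^ 2 ∈ quad H m :=
  Subgroup.subset_closure (Or.inl ⟨a, ha, hm, u, hu, rfl⟩)

theorem commutator_mem_quad {H : Subgroup Γ} {m a b : ℕ} (ha : 1 ≤ a) (hb : 1 ≤ b)
    (hm : m ≤ a + b) {u v : Γ} (hu : u ∈ layer H a) (hv : v ∈ layer H b) : ⁅u, v⁆ ∈ quad H m :=
  Subgroup.subset_closure (Or.inr ⟨a, b, ha, hb, hm, u, hu, v, hv, rfl⟩)

theorem quad_antitone (H : Subgroup Γ) : Antitone (quad H) := by
  intro m n hmn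
  refine Subgroup.closure_mono (Set.union_subset_union ?_ ?_)
  · rintro g ⟨a, ha, hn, h⟩
    exact ⟨a, ha, hmn.trans hn, h⟩
  · rintro g ⟨a, b, ha, hb, hn, h⟩
    exact ⟨a, b, ha, hb, hmn.trans hn, h⟩

theorem layer_antitone (H : Subgroup Γ) : Antitone (layer H) := fun _ _ h =>
  inf_le_inf_right _ (gamma_antitone h)

theorem layer_one (H : Subgroup Γ) : layer H 1 = H := by
  rw [layer]; exact inf_eq_right.2 le_top

theorem commutatorElement_mul_right (g a b : Γ) : ⁅g, a * b⁆ = ⁅g, a⁆ * (a * ⁅g, b⁆ * a⁻¹) := by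
  simp only [commutatorElement_def]; group

theorem commutatorElement_mul_left (a b g : Γ) : ⁅a * b, g⁆ = a * ⁅b, g⁆ * a⁻¹ * ⁅a, g⁆ := by
  simp only [commutatorElement_def]; group

theorem conj_eq_commutatorElement_mul (a b : Γ) : a * b * a⁻¹ = ⁅a, b⁆ * b := by
  simp only [commutatorElement_def]; group

theorem commutatorElement_mul_self_left (g u : Γ) : ⁅g * g, u⁆ = ⁅g, ⁅g, u⁆⁆ * ⁅g, u⁆ ^ 2 := by
  simp only [commutatorElement_def, pow_two]; group

theorem commute_mk_iff {K : Subgroup Γ} [K.Normal] {g u : Γ} :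
    Commute (g : Γ ⧸ K) (u : Γ ⧸ K) ↔ ⁅g, u⁆ ∈ K := by
  rw [← commutatorElement_eq_one_iff_commute, ← QuotientGroup.eq_one_iff]
  rfl

namespace IsCyclicExtension

variable {x : Γ} {H Z : Subgroup Γ}

theorem layer_normal (h : IsCyclicExtension x H Z) (i : ℕ) : (layer H i).Normal := by
  have := h.normal
  unfold layer; infer_instance

theorem commutator_mem_layer (h : IsCyclicExtension x H Z) {a : ℕ} (ha : 1 ≤ a) {u : Γ}
    (hu : u ∈ layer H a) (g : Γ) : ⁅g, u⁆ ∈ layer H (a + 1) := by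
  refine ⟨?_, ?_⟩
  · rw [gamma_succ ha, Subgroup.commutator_comm]
    exact Subgroup.commutator_mem_commutator trivial hu.1
  · have := h.normal
    exact Subgroup.commutator_le_right ⊤ H (Subgroup.commutator_mem_commutator trivial hu.2)

theorem quad_le (h : IsCyclicExtension x H Z) (m : ℕ) : quad H m ≤ Z := by
  refine (Subgroup.closure_le _).2 ?_
  rintro g (⟨a, -, -, u, hu, rfl⟩ | ⟨a, b, -, -, -, u, hu, v, hv, rfl⟩)
  · exact h.sq_mem _ hu.2
  · exact h.commutator_mem _ hu.2 _ hv.2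

theorem conj_eq (h : IsCyclicExtension x H Z) {z g : Γ} (hz : z ∈ Z) (hg : g ∈ H) :
    g * z * g⁻¹ = z := by
  rw [← h.comm z hz g hg, mul_inv_cancel_right]

/-- On `quad`, commutation with any group element raises the weight by one. -/
theorem commutator_mem_quad_succ (h : IsCyclicExtension x H Z) {m : ℕ} {q : Γ} (hq : q ∈ quad H m)
    (g : Γ) : ⁅g, q⁆ ∈ quad H (m + 1) := by
  induction hq using Subgroup.closure_induction with
  | mem q hq =>
    rcases hq with ⟨a, ha, hm, u, hu, rfl⟩ | ⟨a, b, ha, hb, hm, u, hu, v, hv, rfl⟩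
    · have hc := h.commutator_mem_layer ha hu g
      have huc := h.commutator_mem _ hu.2 _ hc.2
      have : ⁅g, u ^ 2⁆ = ⁅u, ⁅g, u⁆⁆ * ⁅g, u⁆ ^ 2 := by
        rw [pow_two u, commutatorElement_mul_right, conj_eq_commutatorElement_mul u, ← mul_assoc,
          ← h.comm _ huc _ hc.2, mul_assoc, ← pow_two]
      rw [this]
      exact mul_mem (commutator_mem_quad ha (by omega) (by omega) hu hc)
        (sq_mem_quad (by omega) (by omega) hc)
    · have hc := h.commutator_mem_layer ha hu g
      have hd := h.commutator_mem_layer hb hv g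
      have hdv : ⁅g, v⁆ * v ∈ layer H b := mul_mem (layer_antitone H (Nat.le_succ b) hd) hv
      have : ⁅g, ⁅u, v⁆⁆ = ⁅u, ⁅g, v⁆⁆ * ⁅⁅g, u⁆, ⁅g, v⁆ * v⁆ := by
        have e1 : g * ⁅u, v⁆ * g⁻¹ = ⁅⁅g, u⁆ * u, ⁅g, v⁆ * v⁆ := by
          simp only [commutatorElement_def]; group
        rw [commutatorElement_def g, e1, commutatorElement_mul_left,
          h.conj_eq (h.commutator_mem _ hu.2 _ hdv.2) hc.2, commutatorElement_mul_right u,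
          h.conj_eq (h.commutator_mem _ hu.2 _ hv.2) hd.2, mul_assoc, mul_assoc, ← mul_assoc ⁅u, v⁆,
          h.comm _ (h.commutator_mem _ hu.2 _ hv.2) _ (h.le (h.commutator_mem _ hc.2 _ hdv.2)),
          mul_inv_cancel_right]
      rw [this]
      exact mul_mem (commutator_mem_quad ha (by omega) (by omega) hu hd)
        (commutator_mem_quad (by omega) hb (by omega) hc hdv)
  | one => rw [commutatorElement_one_right]; exact one_mem _
  | mul q r hq hr ihq ihr =>
    rw [commutatorElement_mul_right,
      h.conj_eq (h.quad_le _ ihr) (h.le (h.quad_le m hq))]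
    exact mul_mem ihq ihr
  | inv q hq ih =>
    have : ⁅g, q⁻¹⁆ = q⁻¹ * ⁅g, q⁆⁻¹ * q⁻¹⁻¹ := by simp only [commutatorElement_def]; group
    rw [this, h.conj_eq (inv_mem (h.quad_le _ ih)) (inv_mem (h.le (h.quad_le m hq)))]
    exact inv_mem ih

theorem quad_normal (h : IsCyclicExtension x H Z) (m : ℕ) : (quad H m).Normal where
  conj_mem q hq g := by
    rw [conj_eq_commutatorElement_mul]
    exact mul_mem (quad_antitone H (Nat.le_succ m) (h.commutator_mem_quad_succ hq g)) hq

/-- On `quad`, which has exponent two, commutation with `g ^ (2 ^ l)` is exactly the iterate of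
commutation with `g`. -/
theorem commutator_pow_mem_quad (h : IsCyclicExtension x H Z) (g : Γ) (l : ℕ) {m : ℕ} {z : Γ}
    (hz : z ∈ quad H m) : ⁅g ^ 2 ^ l, z⁆ ∈ quad H (m + 2 ^ l) := by
  induction l generalizing m z with
  | zero => simpa using h.commutator_mem_quad_succ hz g
  | succ l ih =>
    rw [pow_succ, pow_mul, pow_two, commutatorElement_mul_self_left, h.sq_eq_one _ (h.quad_le _ (ih hz)), mul_one,
      mul_two, ← add_assoc]
    exact ih (ih hz)

theorem iterate_mem_layer (h : IsCyclicExtension x H Z) (g : Γ) (n : ℕ) {a : ℕ} (ha : 1 ≤ a) {u : Γ}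
    (hu : u ∈ layer H a) : (fun v => ⁅g, v⁆)^[n] u ∈ layer H (a + n) := by
  induction n with
  | zero => exact hu
  | succ n ih =>
    rw [Function.iterate_succ_apply']
    exact h.commutator_mem_layer (ha.trans (Nat.le_add_right _ _)) ih g

/-- Modulo elements of `quad` of the right weight, commutation with `g ^ (2 ^ l)` is the
`2 ^ l`-fold iterate of commutation with `g`, just as `t ^ (2 ^ l) - 1 = (t - 1) ^ (2 ^ l)` in
characteristic two. -/
theorem exists_commutator_pow_eq (h : IsCyclicExtension x H Z) (g : Γ) (l : ℕ) {a : ℕ} (ha : 1 ≤ a)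
    {u : Γ} (hu : u ∈ layer H a) :
    ∃ z ∈ quad H (a + 2 ^ l), ⁅g ^ 2 ^ l, u⁆ = (fun v => ⁅g, v⁆)^[2 ^ l] u * z := by
  induction l generalizing a u with
  | zero => exact ⟨1, one_mem _, by simp⟩
  | succ l ih =>
    obtain ⟨z, hz, e⟩ := ih ha hu
    have hd := h.iterate_mem_layer g (2 ^ l) ha hu
    obtain ⟨z', hz', e'⟩ := ih (ha.trans (Nat.le_add_right a (2 ^ l))) hd
    set d := (fun v => ⁅g, v⁆)^[2 ^ l] u with hd_def
    have hzZ := h.quad_le _ hz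
    -- `[s ^ 2, u] = [s, c] c ^ 2` with `s = g ^ (2 ^ l)` and `c = [s, u] = d z`.
    have hsq : (d * z) ^ 2 = d ^ 2 := by
      have hc : Commute d z := (h.comm z hzZ d hd.2).symm
      rw [hc.mul_pow, h.sq_eq_one z hzZ, mul_one]
    have hs : ⁅g ^ 2 ^ l, z⁆ ∈ quad H (a + 2 ^ (l + 1)) := by
      have := h.commutator_pow_mem_quad g l hz
      rwa [add_assoc, ← mul_two, ← pow_succ] at this
    have hit : (fun v => ⁅g, v⁆)^[2 ^ (l + 1)] u = (fun v => ⁅g, v⁆)^[2 ^ l] d := by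
      rw [pow_succ, mul_two, Function.iterate_add_apply]
    refine ⟨z' * ⁅g ^ 2 ^ l, z⁆ * d ^ 2, ?_, ?_⟩
    · refine mul_mem (mul_mem ?_ hs) (sq_mem_quad (ha.trans (Nat.le_add_right _ _)) ?_ hd)
      · rwa [add_assoc, ← mul_two, ← pow_succ] at hz'
      · rw [pow_succ]; omega
    · rw [pow_succ, pow_mul, pow_two, commutatorElement_mul_self_left, e, hsq, commutatorElement_mul_right,
        h.conj_eq (h.quad_le _ hs) hd.2, e', ← pow_succ, hit]
      simp only [mul_assoc]

/-- An element of `Γ` is a power of `x` times an element of `H`. -/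
theorem exists_eq_zpow_mul (h : IsCyclicExtension x H Z) (g : Γ) :
    ∃ n : ℤ, ∃ u ∈ H, g = x ^ n * u := by
  have := h.normal
  have hg : g ∈ Subgroup.zpowers x ⊔ H := h.sup_eq ▸ Subgroup.mem_top g
  obtain ⟨_, ⟨n, rfl⟩, u, hu, rfl⟩ := Subgroup.mem_sup_of_normal_right.1 hg
  exact ⟨n, u, hu, rfl⟩

theorem gamma_two_le (h : IsCyclicExtension x H Z) : gamma Γ 2 ≤ ⁅(⊤ : Subgroup Γ), H⁆ := by
  have := h.normal
  rw [gamma_succ le_rfl, Subgroup.commutator_le]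
  intro g₁ _ g₂ _
  obtain ⟨n₁, u₁, hu₁, rfl⟩ := h.exists_eq_zpow_mul g₁
  obtain ⟨n₂, u₂, hu₂, rfl⟩ := h.exists_eq_zpow_mul g₂
  have hc : ∀ g : Γ, ∀ u ∈ H, Commute (g : Γ ⧸ ⁅(⊤ : Subgroup Γ), H⁆) u := fun g u hu =>
    commute_mk_iff.2 (Subgroup.commutator_mem_commutator trivial hu)
  rw [← commute_mk_iff]
  simp only [QuotientGroup.mk_mul, QuotientGroup.mk_zpow]
  have h1 := (Commute.refl (x : Γ ⧸ ⁅(⊤ : Subgroup Γ), H⁆)).zpow_zpow n₁ n₂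
  exact ((h1.mul_right ((hc _ _ hu₂).zpow_left _))).mul_left
    (((hc _ _ hu₁).symm.zpow_right _).mul_right (hc _ _ hu₂))

theorem gamma_le_of_two_le (h : IsCyclicExtension x H Z) {i : ℕ} (hi : 2 ≤ i) : gamma Γ i ≤ H := by
  have := h.normal
  exact (gamma_antitone hi).trans (h.gamma_two_le.trans (Subgroup.commutator_le_right _ _))

/-- Intersecting with `H` loses no commutators: `[Γ, Γ] = [Γ, H]` as `Γ / H` is cyclic. -/
theorem layer_succ_le (h : IsCyclicExtension x H Z) {i : ℕ} (hi : 1 ≤ i) :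
    layer H (i + 1) ≤ ⁅(⊤ : Subgroup Γ), layer H i⁆ := by
  obtain rfl | hi' := hi.eq_or_lt
  · rw [layer_one]
    exact inf_le_left.trans h.gamma_two_le
  · rw [show layer H i = gamma Γ i from inf_eq_left.2 (h.gamma_le_of_two_le hi'),
      Subgroup.commutator_comm, ← gamma_succ hi]
    exact inf_le_left

/-- Modulo `quad`, every element of weight `i + 1` is a commutator of `x` with an element of
weight `i`: such commutators are closed under multiplication, and `H` acts trivially. -/
theorem exists_commutator_eq (h : IsCyclicExtension x H Z) {i : ℕ} (hi : 1 ≤ i) {w : Γ}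
    (hw : w ∈ layer H (i + 1)) : ∃ u ∈ layer H i, ∃ z ∈ quad H (i + 1), w = ⁅x, u⁆ * z := by
  have hn := h.layer_normal i
  have hqn := h.quad_normal (i + 1)
  -- Multiplication and inversion in `C` are those of `layer H i`, up to a commutator in `quad`.
  let C : Subgroup Γ :=
    { carrier := {w | ∃ u ∈ layer H i, ∃ z ∈ quad H (i + 1), w = ⁅x, u⁆ * z}
      one_mem' := ⟨1, one_mem _, 1, one_mem _, by simp⟩
      mul_mem' := by
        rintro _ _ ⟨u, hu, z, hz, rfl⟩ ⟨v, hv, z', hz', rfl⟩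
        have hxv := h.commutator_mem_layer hi hv x
        have huv := h.commutator_mem _ hu.2 _ hxv.2
        refine ⟨u * v, mul_mem hu hv, ⁅u, ⁅x, v⁆⁆⁻¹ * (z * z'), mul_mem (inv_mem
          (commutator_mem_quad hi (by omega) (by omega) hu hxv)) (mul_mem hz hz'), ?_⟩
        rw [commutatorElement_mul_right, conj_eq_commutatorElement_mul u,
          h.comm _ huv _ hxv.2]
        have hzc := h.comm z (h.quad_le _ hz) ⁅x, v⁆ hxv.2
        calc ⁅x, u⁆ * z * (⁅x, v⁆ * z') = ⁅x, u⁆ * (z * ⁅x, v⁆) * z' := by group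
          _ = _ := by rw [hzc]; group
      inv_mem' := by
        rintro _ ⟨u, hu, z, hz, rfl⟩
        have hxu := h.commutator_mem_layer hi hu x
        have hxu' := h.commutator_mem_layer hi (inv_mem hu) x
        have huxu := h.commutator_mem _ hu.2 _ hxu'.2
        refine ⟨u⁻¹, inv_mem hu, ⁅u, ⁅x, u⁻¹⁆⁆ * z⁻¹, mul_mem
          (commutator_mem_quad hi (by omega) (by omega) hu hxu') (inv_mem hz), ?_⟩
        have e : ⁅x, u⁆⁻¹ = u * ⁅x, u⁻¹⁆ * u⁻¹ := by
          simp only [commutatorElement_def]; group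
        rw [mul_inv_rev, h.comm _ (inv_mem (h.quad_le _ hz)) _ (inv_mem hxu.2), e,
          conj_eq_commutatorElement_mul u, h.comm _ huxu _ hxu'.2, mul_assoc] }
  have hx : ∀ n : ℤ, ∀ u ∈ layer H i, ⁅x ^ n, u⁆ ∈ C := by
    have hpos : ∀ n : ℕ, ∀ u ∈ layer H i, ⁅x ^ n, u⁆ ∈ C := by
      intro n
      induction n with
      | zero => intro u _; simp [one_mem]
      | succ n ih =>
        intro u hu
        have e : ⁅x ^ (n + 1), u⁆ = ⁅x ^ n, x * u * x⁻¹⁆ * ⁅x, u⁆ := by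
          simp only [commutatorElement_def, pow_succ]; group
        rw [e]
        exact mul_mem (ih _ (hn.conj_mem u hu x)) ⟨u, hu, 1, one_mem _, by simp⟩
    intro n u hu
    obtain ⟨m, rfl | rfl⟩ := n.eq_nat_or_neg
    · rw [zpow_natCast]; exact hpos m u hu
    · have e : ⁅x ^ (-(m : ℤ)), u⁆ = ⁅x ^ m, (x ^ m)⁻¹ * u * (x ^ m)⁻¹⁻¹⁆⁻¹ := by
        rw [zpow_neg, zpow_natCast]
        simp only [commutatorElement_def]; group
      rw [e]
      exact inv_mem (hpos m _ (hn.conj_mem u hu _))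
  suffices hle : layer H (i + 1) ≤ C from hle hw
  refine (h.layer_succ_le hi).trans (Subgroup.commutator_le.2 ?_)
  intro g _ u hu
  -- Writing `g = x ^ n * v`, the factor `v ∈ H` contributes only an element of `quad`.
  obtain ⟨n, v, hv, rfl⟩ := h.exists_eq_zpow_mul g
  have hvu : ⁅v, u⁆ ∈ quad H (i + 1) :=
    commutator_mem_quad le_rfl hi (by omega) ((layer_one H).symm ▸ hv) hu
  rw [commutatorElement_mul_left]
  exact mul_mem ⟨1, one_mem _, _, hqn.conj_mem _ hvu (x ^ n), by simp⟩ (hx n u hu)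

/-- Modulo `quad`, every element of weight `j + 1` is a `j`-fold commutator `[x, …, [x, u]]` with
`u ∈ H`. -/
theorem exists_iterate_eq (h : IsCyclicExtension x H Z) (j : ℕ) {w : Γ}
    (hw : w ∈ layer H (j + 1)) :
    ∃ u ∈ H, ∃ z ∈ quad H (j + 1), w = (fun v => ⁅x, v⁆)^[j] u * z := by
  induction j generalizing w with
  | zero => exact ⟨w, hw.2, 1, one_mem _, by simp⟩
  | succ j ih =>
    obtain ⟨u, hu, z, hz, rfl⟩ := h.exists_commutator_eq (Nat.le_add_left 1 j) hw
    obtain ⟨v, hv, z', hz', e⟩ := ih hu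
    refine ⟨v, hv, _, mul_mem ((h.quad_normal (j + 1 + 1)).conj_mem _
      (h.commutator_mem_quad_succ hz' x) ((fun v => ⁅x, v⁆)^[j] v)) hz, ?_⟩
    rw [e, commutatorElement_mul_right, Function.iterate_succ_apply', mul_assoc]

variable {k : ℕ}

/-- An element of weight `2 ^ k + 1` is, modulo `quad`, a `2 ^ k`-fold commutator with `x`, and hence
a commutator with `x ^ (2 ^ k) = 1`. -/
theorem layer_two_pow_succ_le (h : IsCyclicExtension x H Z) (hx : x ^ 2 ^ k = 1) :
    layer H (2 ^ k + 1) ≤ quad H (2 ^ k + 1) := by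
  intro w hw
  obtain ⟨u, hu, z, hz, rfl⟩ := h.exists_iterate_eq _ hw
  obtain ⟨z', hz', e⟩ := h.exists_commutator_pow_eq x k le_rfl ((layer_one H).symm ▸ hu)
  rw [hx, commutatorElement_one_left, eq_comm, mul_eq_one_iff_eq_inv] at e
  rw [e]
  refine mul_mem (inv_mem ?_) hz
  rwa [add_comm]

theorem layer_le_quad (h : IsCyclicExtension x H Z) (hx : x ^ 2 ^ k = 1) {m : ℕ}
    (hm : 2 ^ k + 1 ≤ m) : layer H m ≤ quad H m := by
  induction m, hm using Nat.le_induction with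
  | base => exact h.layer_two_pow_succ_le hx
  | succ m hm ih =>
    refine (h.layer_succ_le ((Nat.le_add_left 1 _).trans hm)).trans
      (Subgroup.commutator_le.2 fun g _ u hu => ?_)
    exact h.commutator_mem_quad_succ (ih hu) g

/-- Of two weights with sum above `2 ^ (k + 1)`, one exceeds `2 ^ k`, and the elements of `H` of such
weight are central involutions of `H`. -/
theorem quad_eq_bot (h : IsCyclicExtension x H Z) (hx : x ^ 2 ^ k = 1) :
    quad H (2 ^ (k + 1) + 1) = ⊥ := by
  have hZ : ∀ a, 2 ^ k + 1 ≤ a → ∀ u ∈ layer H a, u ∈ Z := fun a ha u hu =>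
    h.quad_le _ (h.layer_le_quad hx ha hu)
  rw [eq_bot_iff, quad, Subgroup.closure_le]
  rw [pow_succ]
  rintro g (⟨a, -, hm, u, hu, rfl⟩ | ⟨a, b, -, -, hm, u, hu, v, hv, rfl⟩)
  · exact h.sq_eq_one u (hZ a (by omega) u hu)
  · refine commutatorElement_eq_one_iff_mul_comm.2 ?_
    by_cases ha : 2 ^ k + 1 ≤ a
    · exact h.comm u (hZ a ha u hu) v hv.2
    · exact (h.comm v (hZ b (by omega) v hv) u hu.2).symm

/-! ### The dimension subgroup series of the extension -/

theorem sup_normal (h : IsCyclicExtension x H Z) (i : ℕ) : (layer H i ⊔ quad H i).Normal := by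
  have := h.layer_normal i
  have := h.quad_normal i
  infer_instance

theorem exists_eq_mul_of_mem_sup (h : IsCyclicExtension x H Z) {i : ℕ} {e : Γ}
    (he : e ∈ layer H i ⊔ quad H i) : ∃ u ∈ layer H i, ∃ z ∈ quad H i, e = u * z := by
  have := h.quad_normal i
  obtain ⟨u, hu, z, hz, rfl⟩ := Subgroup.mem_sup_of_normal_right.1 he
  exact ⟨u, hu, z, hz, rfl⟩

theorem sup_antitone (H : Subgroup Γ) : Antitone fun i => layer H i ⊔ quad H i := fun _ _ h =>
  sup_le_sup (layer_antitone H h) (quad_antitone H h)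

/-- The factor from `quad` is a central involution, so it does not contribute to the square. -/
theorem sq_mem_quad_of_mem_sup (h : IsCyclicExtension x H Z) {i : ℕ} (hi : 1 ≤ i) {e : Γ}
    (he : e ∈ layer H i ⊔ quad H i) : e ^ 2 ∈ quad H (2 * i) := by
  obtain ⟨u, hu, z, hz, rfl⟩ := h.exists_eq_mul_of_mem_sup he
  have hc : Commute u z := (h.comm z (h.quad_le _ hz) u hu.2).symm
  rw [hc.mul_pow, h.sq_eq_one z (h.quad_le _ hz), mul_one]
  exact sq_mem_quad hi le_rfl hu

theorem commutator_mem_quad_of_mem_sup (h : IsCyclicExtension x H Z) {i j : ℕ} (hi : 1 ≤ i)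
    (hj : 1 ≤ j) {e f : Γ} (he : e ∈ layer H i ⊔ quad H i) (hf : f ∈ layer H j ⊔ quad H j) :
    ⁅e, f⁆ ∈ quad H (i + j) := by
  obtain ⟨u, hu, z, hz, rfl⟩ := h.exists_eq_mul_of_mem_sup he
  obtain ⟨v, hv, w, hw, rfl⟩ := h.exists_eq_mul_of_mem_sup hf
  have hz' := h.quad_le _ hz
  have hw' := h.quad_le _ hw
  have h1 : ⁅z, v * w⁆ = 1 :=
    commutatorElement_eq_one_iff_mul_comm.2 (h.comm z hz' _ (mul_mem hv.2 (h.le hw')))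
  have h2 : ⁅u, w⁆ = 1 := commutatorElement_eq_one_iff_mul_comm.2 (h.comm w hw' u hu.2).symm
  rw [commutatorElement_mul_left, h1, commutatorElement_mul_right, h2]
  simpa using commutator_mem_quad hi hj le_rfl hu hv

theorem commutator_pow_mem_sup (h : IsCyclicExtension x H Z) (l : ℕ) {j : ℕ} (hj : 1 ≤ j) {e : Γ}
    (he : e ∈ layer H j ⊔ quad H j) :
    ⁅x ^ 2 ^ l, e⁆ ∈ layer H (j + 2 ^ l) ⊔ quad H (j + 2 ^ l) := by
  obtain ⟨u, hu, z, hz, rfl⟩ := h.exists_eq_mul_of_mem_sup he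
  obtain ⟨z', hz', e'⟩ := h.exists_commutator_pow_eq x l hj hu
  have hs := h.commutator_pow_mem_quad x l hz
  rw [commutatorElement_mul_right, h.conj_eq (h.quad_le _ hs) hu.2, e']
  exact mul_mem (mul_mem (Subgroup.mem_sup_left (h.iterate_mem_layer x _ hj hu))
    (Subgroup.mem_sup_right hz')) (Subgroup.mem_sup_right hs)

/-- The series that bounds the dimension subgroup series of the extension from above. -/
def upper (x : Γ) (H : Subgroup Γ) (i : ℕ) : Subgroup Γ :=
  Subgroup.zpowers (x ^ 2 ^ Nat.clog 2 i) ⊔ (layer H i ⊔ quad H i)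

theorem exists_eq_mul_of_mem_upper (h : IsCyclicExtension x H Z) {i : ℕ} {g : Γ}
    (hg : g ∈ upper x H i) :
    ∃ n : ℤ, ∃ e ∈ layer H i ⊔ quad H i, g = (x ^ 2 ^ Nat.clog 2 i) ^ n * e := by
  have := h.sup_normal i
  obtain ⟨_, ⟨n, rfl⟩, e, he, rfl⟩ := Subgroup.mem_sup_of_normal_right.1 hg
  exact ⟨n, e, he, rfl⟩

theorem upper_one (h : IsCyclicExtension x H Z) : upper x H 1 = ⊤ := by
  rw [upper, eq_top_iff, ← h.sup_eq, layer_one]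
  simp only [Nat.clog_one_right, pow_zero, pow_one]
  exact sup_le_sup_left le_sup_left _

/-- `x ^ (2 ^ l(i))` and the elements of `H` of weight `j` commute modulo weight `i + j`. -/
theorem commute_mk_zpow (h : IsCyclicExtension x H Z) {i j : ℕ} (hj : 1 ≤ j) {e : Γ}
    (he : e ∈ layer H j ⊔ quad H j) (K : Subgroup Γ) [K.Normal]
    (hK : layer H (i + j) ⊔ quad H (i + j) ≤ K) (n : ℤ) :
    Commute (((x ^ 2 ^ Nat.clog 2 i) ^ n : Γ) : Γ ⧸ K) (e : Γ ⧸ K) := by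
  rw [QuotientGroup.mk_zpow]
  refine Commute.zpow_left (commute_mk_iff.2 (hK ?_)) n
  refine sup_antitone H ?_ (h.commutator_pow_mem_sup (Nat.clog 2 i) hj he)
  have := Nat.le_pow_clog one_lt_two i
  omega

theorem commutator_upper_le (h : IsCyclicExtension x H Z) {i j : ℕ} (hi : 1 ≤ i) (hj : 1 ≤ j) :
    ⁅upper x H i, upper x H j⁆ ≤ upper x H (i + j) := by
  refine Subgroup.commutator_le.2 fun g hg f hf => ?_
  obtain ⟨n, e, he, rfl⟩ := h.exists_eq_mul_of_mem_upper hg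
  obtain ⟨m, d, hd, rfl⟩ := h.exists_eq_mul_of_mem_upper hf
  have := h.sup_normal (i + j)
  refine Subgroup.mem_sup_right (commute_mk_iff.1 ?_)
  rw [QuotientGroup.mk_mul, QuotientGroup.mk_mul]
  refine Commute.mul_left (Commute.mul_right ?_ ?_) (Commute.mul_right ?_ ?_)
  · simp only [QuotientGroup.mk_zpow, QuotientGroup.mk_pow]
    exact (((Commute.refl _).pow_pow _ _).zpow_zpow _ _)
  · exact h.commute_mk_zpow hj hd _ le_rfl n
  · exact (h.commute_mk_zpow hi he _ (by rw [add_comm]) m).symm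
  · exact commute_mk_iff.2 (Subgroup.mem_sup_right (h.commutator_mem_quad_of_mem_sup hi hj he hd))

theorem sq_mem_upper (h : IsCyclicExtension x H Z) {n : ℕ} (hn : 2 ≤ n) {g : Γ}
    (hg : g ∈ upper x H (n ⌈/⌉ 2)) : g ^ 2 ∈ upper x H n := by
  rw [upper, clog_two_ceilDiv hn]
  have hle : n ≤ 2 * (n ⌈/⌉ 2) := by rw [ceilDiv_two]; omega
  have hi : 1 ≤ n ⌈/⌉ 2 := by rw [ceilDiv_two]; omega
  generalize n ⌈/⌉ 2 = i at *
  obtain ⟨m, e, he, rfl⟩ := h.exists_eq_mul_of_mem_upper hg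
  have := h.sup_normal n
  set s := x ^ 2 ^ Nat.clog 2 i with hs
  -- The factors commute modulo weight `n`, so the square is the product of the squares.
  have hc : Commute ((s ^ m : Γ) : Γ ⧸ layer H n ⊔ quad H n) e :=
    h.commute_mk_zpow hi he _ (sup_antitone H (by omega)) m
  have he2 : ((e ^ 2 : Γ) : Γ ⧸ layer H n ⊔ quad H n) = 1 :=
    (QuotientGroup.eq_one_iff _).2
      (Subgroup.mem_sup_right (quad_antitone H hle (h.sq_mem_quad_of_mem_sup hi he)))
  have hmem : ((s ^ m) ^ 2)⁻¹ * (s ^ m * e) ^ 2 ∈ layer H n ⊔ quad H n := by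
    rw [← QuotientGroup.eq]
    rw [QuotientGroup.mk_pow _ (s ^ m * e), QuotientGroup.mk_mul, hc.mul_pow,
      ← QuotientGroup.mk_pow _ e, he2, mul_one, QuotientGroup.mk_pow]
  have hs2 : (s ^ m) ^ 2 = (x ^ 2 ^ (Nat.clog 2 i + 1)) ^ m := by
    rw [pow_succ 2, pow_mul, ← hs, ← zpow_natCast (s ^ m), ← zpow_natCast s, zpow_comm]
  rw [← mul_inv_cancel_left ((s ^ m) ^ 2) ((s ^ m * e) ^ 2)]
  exact mul_mem (Subgroup.mem_sup_left (hs2 ▸ Subgroup.zpow_mem_zpowers _ m))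
    (Subgroup.mem_sup_right hmem)

theorem dimensionSeries_le_upper (h : IsCyclicExtension x H Z) {i : ℕ} (hi : 1 ≤ i) :
    dimensionSeries 2 Γ i ≤ upper x H i :=
  dimensionSeries_le h.upper_one (fun _ hn _ hg => h.sq_mem_upper hn hg)
    (fun _ _ hi hj => h.commutator_upper_le hi hj) hi

theorem upper_le {i : ℕ} (H : Subgroup Γ) (x : Γ) :
    upper x H i ≤ Subgroup.zpowers (x ^ 2 ^ Nat.clog 2 i) ⊔
      powSubgroup (gamma Γ (i ⌈/⌉ 2)) 2 ⊔ gamma Γ i := by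
  refine sup_le (le_sup_left.trans le_sup_left) (sup_le (inf_le_left.trans le_sup_right) ?_)
  refine (Subgroup.closure_le _).2 ?_
  rintro g (⟨a, -, hm, u, hu, rfl⟩ | ⟨a, b, ha, hb, hm, u, hu, v, hv, rfl⟩)
  · refine Subgroup.mem_sup_left (Subgroup.mem_sup_right (sq_mem_powSubgroup
      (gamma_antitone ?_ hu.1)))
    rw [ceilDiv_two]; omega
  · exact Subgroup.mem_sup_right (gamma_antitone hm
      (gamma_commutator_le ha hb (Subgroup.commutator_mem_commutator hu.1 hv.1)))

/-- The dimension subgroups lie in `upper`, which lies in the product of the formula, which lies in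
the dimension subgroups. -/
theorem dimensionSeries_eq (h : IsCyclicExtension x H Z) {i : ℕ} (hi : 1 ≤ i) :
    dimensionSeries 2 Γ i = Subgroup.zpowers (x ^ 2 ^ Nat.clog 2 i) ⊔
      powSubgroup (gamma Γ (i ⌈/⌉ 2)) 2 ⊔ gamma Γ i :=
  le_antisymm ((h.dimensionSeries_le_upper hi).trans (upper_le H x)) (sup_le_dimensionSeries x hi)

theorem dimensionSeries_eq_bot (h : IsCyclicExtension x H Z) (hx : x ^ 2 ^ k = 1) :
    dimensionSeries 2 Γ (2 ^ (k + 1) + 1) = ⊥ := by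
  rw [eq_bot_iff]
  refine (h.dimensionSeries_le_upper (Nat.le_add_left 1 _)).trans (sup_le ?_ (sup_le ?_ ?_))
  · have hl : k ≤ Nat.clog 2 (2 ^ (k + 1) + 1) := by
      have := Nat.clog_mono_right 2 (Nat.le_succ (2 ^ (k + 1)))
      rw [Nat.clog_pow _ _ one_lt_two] at this
      exact (Nat.le_succ k).trans this
    rw [Subgroup.zpowers_le, Subgroup.mem_bot, ← Nat.add_sub_of_le hl, pow_add, pow_mul, hx,
      one_pow]
  · exact (h.layer_le_quad hx (by rw [pow_succ]; omega)).trans (h.quad_eq_bot hx).le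
  · exact (h.quad_eq_bot hx).le

end IsCyclicExtension

end GroupSeries

/-! ### The free pro-2 group and its finite quotients -/

namespace FreePro2

instance (N : TwoPowerNormal) : Finite (FinQuot N) := by
  obtain ⟨n, hn⟩ := N.2.2
  exact Nat.finite_of_card_ne_zero (hn.trans_ne (pow_ne_zero n two_ne_zero))

theorem isPGroup_pi_finQuot (I : Finset TwoPowerNormal) : IsPGroup 2 (∀ N : I, FinQuot N.1) := by
  choose n hn using fun N : TwoPowerNormal => N.2.2
  apply IsPGroup.of_card (n := ∑ N : I, n N.1)
  rw [Nat.card_pi, ← Finset.prod_pow_eq_pow_sum]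
  exact Finset.prod_congr rfl fun N _ => hn N.1

/-- Finitely many coordinates of an element of the limit are determined by the coordinate at the
intersection of their kernels, which an element of the free group realizes. -/
theorem dense_range_ofFree : DenseRange ofFree := by
  intro f
  rw [mem_closure_iff]
  rintro _ ⟨V, hV, rfl⟩ hf
  obtain ⟨I, u, hu, hIV⟩ := isOpen_pi_iff.1 hV _ hf
  let φ : FreeGroup (Fin 2) →* ∀ N : I, FinQuot N.1 := MonoidHom.pi fun N => toFinQuot N.1
  let M := kerTwoPower (isPGroup_pi_finQuot I) φ
  obtain ⟨w, hw⟩ := QuotientGroup.mk'_surjective M.1 (f.1 M)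
  refine ⟨ofFree w, hIV fun N hN => ?_, w, rfl⟩
  have hle : M.1 ≤ N.1 := fun v hv =>
    (QuotientGroup.eq_one_iff v).1 (congrFun (MonoidHom.mem_ker.1 hv) ⟨N, hN⟩)
  have : (ofFree w).1 N = f.1 N := by
    rw [← f.2 M N hle, ← hw]
    rfl
  rw [this]
  exact (hu N hN).2

theorem isClosed_ker_lift {P : Type} [Group P] [Finite P] (hP : IsPGroup 2 P)
    (φ : FreeGroup (Fin 2) →* P) : IsClosed ((lift hP φ).ker : Set F) := by
  have hc : Continuous fun f : F => f.1 (kerTwoPower hP φ) :=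
    (continuous_apply _).comp continuous_subtype_val
  exact (isClosed_discrete
    {q : FinQuot (kerTwoPower hP φ) | QuotientGroup.kerLift φ q = 1}).preimage hc

/-- Both sides are read off from one element of the free group that represents `f` modulo the
kernel of `φ`. -/
theorem lift_comp {P Q : Type} [Group P] [Finite P] [Group Q] [Finite Q] (hP : IsPGroup 2 P)
    (hQ : IsPGroup 2 Q) (φ : FreeGroup (Fin 2) →* P) (ψ : P →* Q) (f : F) :
    lift hQ (ψ.comp φ) f = ψ (lift hP φ f) := by
  obtain ⟨w, hw⟩ := QuotientGroup.mk'_surjective _ (f.1 (kerTwoPower hP φ))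
  have hle : (kerTwoPower hP φ).1 ≤ (kerTwoPower hQ (ψ.comp φ)).1 := fun v hv => by
    have hv' : φ v = 1 := hv
    exact MonoidHom.mem_ker.2 (by rw [MonoidHom.comp_apply, hv', map_one])
  have h1 : lift hP φ f = φ w := congrArg (QuotientGroup.kerLift φ) hw.symm
  have h2 : f.1 (kerTwoPower hQ (ψ.comp φ)) = toFinQuot _ w := by
    rw [← f.2 _ _ hle, ← hw]
    rfl
  have h3 : lift hQ (ψ.comp φ) f = ψ (φ w) := congrArg (QuotientGroup.kerLift (ψ.comp φ)) h2
  rw [h1, h3]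

/-- The free pro-2 group is generated by `a` and `b` modulo any closed normal subgroup for which
the images generate a finite subgroup: this subgroup is closed and dense. -/
theorem closure_mk_eq_top (K : Subgroup F) [K.Normal] (hK : IsClosed (K : Set F))
    (hfin : Finite (Subgroup.closure {(a : F ⧸ K), (b : F ⧸ K)})) :
    Subgroup.closure {(a : F ⧸ K), (b : F ⧸ K)} = ⊤ := by
  set L := Subgroup.closure {(a : F ⧸ K), (b : F ⧸ K)} with hL
  have hcl : IsClosed (L : Set (F ⧸ K)) := Set.Finite.isClosed hfin
  have hpre : IsClosed ((QuotientGroup.mk : F → F ⧸ K) ⁻¹' L) :=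
    hcl.preimage QuotientGroup.continuous_mk
  have hgen : ∀ w, (ofFree w : F ⧸ K) ∈ L := fun w => by
    induction w using FreeGroup.induction_on with
    | C1 => exact one_mem L
    | of i =>
      fin_cases i
      · exact Subgroup.subset_closure (Or.inl rfl)
      · exact Subgroup.subset_closure (Or.inr rfl)
    | inv_of i h => rw [map_inv]; exact inv_mem h
    | mul v w hv hw => rw [map_mul]; exact mul_mem hv hw
  have hsub : Set.univ ⊆ (QuotientGroup.mk : F → F ⧸ K) ⁻¹' L := by
    rw [← dense_range_ofFree.closure_range]
    exact hpre.closure_subset_iff.2 (Set.range_subset_iff.2 hgen)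
  rw [eq_top_iff]
  intro g _
  obtain ⟨f, rfl⟩ := QuotientGroup.mk_surjective g
  exact hsub trivial

end FreePro2

/-- A finitely generated subgroup is finite if a subgroup of finite index in the whole group is
commutative of exponent two. -/
theorem Subgroup.finite_of_fg_of_finiteIndex {Γ : Type*} [Group Γ] {L Z : Subgroup Γ} (hL : L.FG)
    [Z.FiniteIndex] (hcomm : ∀ g ∈ Z, ∀ h ∈ Z, g * h = h * g) (hsq : ∀ g ∈ Z, g ^ 2 = 1) :
    Finite L := by
  have : Group.FG L := (Group.fg_iff_subgroup_fg L).2 hL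
  let A := Z.subgroupOf L
  have : Group.FG A := inferInstance
  let _ : CommGroup A :=
    { (inferInstance : Group A) with
      mul_comm := fun g h => Subtype.ext (Subtype.ext (hcomm _ g.2 _ h.2)) }
  have : Finite A := CommGroup.finite_of_fg_isMulTorsion A fun g =>
    isOfFinOrder_iff_pow_eq_one.2 ⟨2, two_pos, Subtype.ext (Subtype.ext (hsq _ g.2))⟩
  have : Finite (L ⧸ A) := Subgroup.finite_quotient_of_finiteIndex
  exact Finite.of_subgroup_quotient A

namespace RegularWreathProduct

variable {D D' Q : Type*} [Group D] [Group D'] [Group Q]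

/-- The base group of a wreath product of a commutative group is commutative. -/
theorem mul_comm_of_right_eq_one {A : Type*} [CommGroup A] {v w : A ≀ᵣ Q} (hv : v.right = 1)
    (hw : w.right = 1) : v * w = w * v := by
  ext : 1
  · simp [hv, hw, mul_comm]
  · simp [hv, hw]

/-- The homomorphism of regular wreath products that applies a homomorphism to every coordinate of
the base group. -/
def mapLeft (f : D →* D') : D ≀ᵣ Q →* D' ≀ᵣ Q where
  toFun w := ⟨fun q => f (w.left q), w.right⟩
  map_one' := by ext <;> simp
  map_mul' _ _ := by ext <;> simp

open scoped commutatorElement in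
theorem commutator_inl (t : Q) (f : Q → D) :
    ⁅(inl t : D ≀ᵣ Q), (⟨f, 1⟩ : D ≀ᵣ Q)⁆ = ⟨fun q => f (t⁻¹ * q) * (f q)⁻¹, 1⟩ := by
  ext <;> simp [commutatorElement_def]

end RegularWreathProduct

/-! ### The quotient `C_4 ≀ C_{2^k}` of `G_k` -/

namespace GroupG

open FreePro2 GroupSeries
open scoped commutatorElement

/-- The wreath product of the cyclic group of order `4` by the cyclic group of order `2 ^ k`. -/
abbrev V (k : ℕ) : Type := Multiplicative (ZMod 4) ≀ᵣ Multiplicative (ZMod (2 ^ k))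

theorem isPGroup_V (k : ℕ) : IsPGroup 2 (V k) := by
  apply IsPGroup.of_card (n := 2 * 2 ^ k + k)
  rw [RegularWreathProduct.card, pow_add, pow_mul]
  simp only [Nat.card_eq_of_bijective _ Multiplicative.toAdd.bijective, Nat.card_zmod]
  norm_num

/-- The generator of the top group of `V k`. -/
def xV (k : ℕ) : V k := RegularWreathProduct.inl (Multiplicative.ofAdd 1)

/-- The generator of the base group of `V k`, in the coordinate at the identity. -/
def yV (k : ℕ) : V k := ⟨Pi.mulSingle 1 (Multiplicative.ofAdd 1), 1⟩

/-- The homomorphism of the free pro-2 group to `V k` that sends the free generators to `xV k`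
and `yV k`. -/
def toV (k : ℕ) : F →* V k := lift (isPGroup_V k) (FreeGroup.lift ![xV k, yV k])

theorem toV_a (k : ℕ) : toV k a = xV k := by
  rw [toV, a, lift_ofFree]; simp

theorem toV_b (k : ℕ) : toV k b = yV k := by
  rw [toV, b, lift_ofFree]; simp

theorem toW_b (k : ℕ) : toW k b = yDot k := by
  rw [toW, b, lift_ofFree]; simp

/-- Reduction of the base group modulo `2`. -/
def reduction (k : ℕ) : V k →* W k :=
  RegularWreathProduct.mapLeft
    (ZMod.castHom (show 2 ∣ 4 by decide) (ZMod 2)).toAddMonoidHom.toMultiplicative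

theorem reduction_toV (k : ℕ) (f : F) : reduction k (toV k f) = toW k f := by
  have h : (reduction k).comp (FreeGroup.lift ![xV k, yV k]) =
      FreeGroup.lift ![xDot k, yDot k] := by
    ext i : 1
    fin_cases i
    · ext : 1
      · ext; simp [reduction, xV, xDot, RegularWreathProduct.mapLeft]
      · simp [reduction, xV, xDot, RegularWreathProduct.mapLeft]
    · ext : 1
      · funext q
        by_cases hq : q = 1
        · subst hq
          simp [reduction, yV, yDot, RegularWreathProduct.mapLeft]
        · simp [reduction, yV, yDot, RegularWreathProduct.mapLeft, Pi.mulSingle_eq_of_ne hq]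
      · simp [reduction, yV, yDot, RegularWreathProduct.mapLeft]
  rw [toW, toV, ← h, lift_comp (isPGroup_V k)]

theorem right_eq_one_of_mem_Y {k : ℕ} {f : F} (hf : f ∈ Y k) : (toV k f).right = 1 := by
  have h : (toW k f).right = 1 := hf
  rwa [← reduction_toV] at h

theorem R_le_Y (k : ℕ) : R k ≤ Y k := fun f hf => by
  have h : toW k f = 1 := hf
  exact Subgroup.mem_comap.2 (h ▸ one_mem _)

/-- The image of `R_k` lies in twice the base group of `V k`. -/
theorem toV_sq_of_mem_R {k : ℕ} {f : F} (hf : f ∈ R k) : toV k f ^ 2 = 1 := by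
  have h1 := right_eq_one_of_mem_Y (R_le_Y k hf)
  have h : reduction k (toV k f) = 1 := (reduction_toV k f).trans hf
  have key : ∀ z : Multiplicative (ZMod 4),
      (ZMod.castHom (show 2 ∣ 4 by decide) (ZMod 2)).toAddMonoidHom.toMultiplicative z = 1 →
        z * z = 1 := by decide
  rw [pow_two]
  ext : 1
  · funext q
    simp only [RegularWreathProduct.mul_left, h1, inv_one, one_mul, Pi.mul_apply]
    exact (key _ (congrFun (congrArg RegularWreathProduct.left h) q))
  · simp [h1]

theorem xV_pow (k : ℕ) : xV k ^ 2 ^ k = 1 := by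
  rw [xV, ← map_pow, ← ofAdd_nsmul]
  simp

/-- `V k` is a quotient of `G_k`. -/
theorem N_le_ker (k : ℕ) : N k ≤ (toV k).ker := by
  refine Subgroup.topologicalClosure_minimal _ (sup_le (sup_le ?_ ?_) ?_) (isClosed_ker_lift _ _)
  · refine Subgroup.commutator_le.2 fun g hg h hh => ?_
    rw [MonoidHom.mem_ker, map_commutatorElement, commutatorElement_eq_one_iff_mul_comm]
    exact RegularWreathProduct.mul_comm_of_right_eq_one
      (right_eq_one_of_mem_Y (R_le_Y k hg)) (right_eq_one_of_mem_Y hh)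
  · refine (Subgroup.closure_le _).2 ?_
    rintro _ ⟨g, hg, rfl⟩
    exact MonoidHom.mem_ker.2 (by rw [map_pow, toV_sq_of_mem_R hg])
  · refine Subgroup.normalClosure_le_normal (Set.singleton_subset_iff.2 ?_)
    exact MonoidHom.mem_ker.2 (by rw [map_pow, toV_a, xV_pow])

/-- The coefficients of `(t - 1) ^ n` in the group ring over `ZMod 4` of the cyclic group of order
`2 ^ k` with generator `t`. -/
def coeff (k : ℕ) : ℕ → ZMod (2 ^ k) → ZMod 4
  | 0 => Pi.single 0 1
  | n + 1 => fun i => coeff k n (i - 1) - coeff k n i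

theorem coeff_succ (k n : ℕ) (i : ZMod (2 ^ k)) :
    coeff k (n + 1) i = coeff k n (i - 1) - coeff k n i := rfl

theorem iterate_commutator_yV (k n : ℕ) : (fun v => ⁅xV k, v⁆)^[n] (yV k) =
    ⟨fun i => Multiplicative.ofAdd (coeff k n i.toAdd), 1⟩ := by
  induction n with
  | zero =>
    ext : 1
    · funext q
      by_cases hq : q = 1
      · subst hq
        simp [yV, coeff]
      · have hq' : q.toAdd ≠ 0 := hq
        simp [yV, coeff, Pi.mulSingle_eq_of_ne hq, Pi.single_eq_of_ne hq']
    · rfl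
  | succ n ih =>
    rw [Function.iterate_succ_apply', ih, xV, RegularWreathProduct.commutator_inl]
    ext : 1
    · funext q
      simp only [coeff, toAdd_mul, toAdd_inv, toAdd_ofAdd, neg_add_eq_sub]
      rw [← div_eq_mul_inv, ← ofAdd_sub]
    · rfl

theorem coeff_of_lt {k n j : ℕ} (hj : j < 2 ^ k) (hn : n < j) : coeff k n j = 0 := by
  induction n generalizing j with
  | zero =>
    refine Pi.single_eq_of_ne ?_ _
    rw [Ne, ZMod.natCast_eq_zero_iff]
    exact Nat.not_dvd_of_pos_of_lt hn hj
  | succ n ih =>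
    obtain ⟨i, rfl⟩ := Nat.exists_eq_add_of_le' (show 1 ≤ j by omega)
    rw [coeff_succ, Nat.cast_add, Nat.cast_one, add_sub_cancel_right, ih (by omega) (by omega)]
    rw [← Nat.cast_one, ← Nat.cast_add, ih hj (by omega), sub_zero]

/-- The constant coefficient of `(t - 1) ^ n` is `± 1` as long as nothing wraps around. -/
theorem coeff_zero {k n : ℕ} (hn : n < 2 ^ k) : coeff k n 0 = (-1) ^ n := by
  induction n with
  | zero => simp [coeff]
  | succ n ih =>
    have h : (0 - 1 : ZMod (2 ^ k)) = ((2 ^ k - 1 : ℕ) : ZMod (2 ^ k)) := by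
      rw [Nat.cast_sub Nat.one_le_two_pow]; simp
    rw [coeff_succ, h, coeff_of_lt (by omega) (by omega), ih (by omega), pow_succ]
    ring

theorem sq_iterate_commutator_yV_ne_one (k : ℕ) :
    ((fun v => ⁅xV k, v⁆)^[2 ^ k - 1] (yV k)) ^ 2 ≠ 1 := by
  rw [iterate_commutator_yV, pow_two]
  intro h
  have h0 := congrFun (congrArg RegularWreathProduct.left h) 1
  simp only [RegularWreathProduct.mul_left, inv_one, one_mul, Pi.mul_apply,
    RegularWreathProduct.one_left, Pi.one_apply, toAdd_one,
    coeff_zero (Nat.sub_lt (Nat.two_pow_pos k) one_pos)] at h0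
  rcases neg_one_pow_eq_or (ZMod 4) (2 ^ k - 1) with e | e <;> rw [e] at h0 <;>
    exact absurd h0 (by decide)

/-! ### The structure of `G_k` -/

/-- The image of the second generator in `G_k`. -/
def y (k : ℕ) : G k := QuotientGroup.mk b

theorem b_mem_Y (k : ℕ) : b ∈ Y k := by
  refine Subgroup.mem_comap.2 ?_
  rw [toW_b]
  rfl

theorem mk_mem_N {k : ℕ} {f : F} (hf : f ∈ ⁅R k, Y k⁆ ⊔ powSubgroup (R k) 2 ⊔
    Subgroup.normalClosure {a ^ (2 ^ k)}) : (f : G k) = 1 :=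
  (QuotientGroup.eq_one_iff f).2 (Subgroup.le_topologicalClosure _ hf)

theorem x_pow (k : ℕ) : x k ^ 2 ^ k = 1 :=
  mk_mem_N (Subgroup.mem_sup_right (Subgroup.subset_normalClosure rfl))

theorem mk_comm {k : ℕ} {f g : F} (hf : f ∈ R k) (hg : g ∈ Y k) : (f : G k) * g = g * f :=
  commutatorElement_eq_one_iff_mul_comm.1
    (mk_mem_N (Subgroup.mem_sup_left (Subgroup.mem_sup_left
      (Subgroup.commutator_mem_commutator hf hg))))

theorem mk_sq {k : ℕ} {f : F} (hf : f ∈ R k) : (f : G k) ^ 2 = 1 :=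
  mk_mem_N (Subgroup.mem_sup_left (Subgroup.mem_sup_right (sq_mem_powSubgroup hf)))

/-- `G_k` is generated by `x_k` and `y_k` as an abstract group: modulo the image of `R_k`, which is
abelian of exponent two and has finite index, Schreier's lemma shows that they generate a finite
group. -/
theorem closure_eq_top (k : ℕ) : Subgroup.closure {x k, y k} = ⊤ := by
  refine closure_mk_eq_top (N k) (Subgroup.isClosed_topologicalClosure _) ?_
  have hi : ((R k).map (QuotientGroup.mk' (N k))).FiniteIndex := by
    have hR : (R k).FiniteIndex := Subgroup.finiteIndex_ker _
    exact ⟨ne_zero_of_dvd_ne_zero hR.index_ne_zero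
      (Subgroup.index_map_dvd _ (QuotientGroup.mk'_surjective _))⟩
  refine Subgroup.finite_of_fg_of_finiteIndex
    (Z := (R k).map (QuotientGroup.mk' (N k))) ((Subgroup.fg_iff _).2 ⟨_, rfl, Set.toFinite _⟩) ?_ ?_
  · rintro _ ⟨f, hf, rfl⟩ _ ⟨g, hg, rfl⟩
    exact mk_comm hf (R_le_Y k hg)
  · rintro _ ⟨f, hf, rfl⟩
    exact mk_sq hf

theorem y_mem (k : ℕ) : y k ∈ (Y k).map (QuotientGroup.mk' (N k)) := ⟨b, b_mem_Y k, rfl⟩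

theorem sq_eq_one_of_mem_B {k : ℕ} {w : W k} (hw : w ∈ B k) : w ^ 2 = 1 := by
  have hw : w.right = 1 := hw
  have key : ∀ z : Multiplicative (ZMod 2), z * z = 1 := by decide
  rw [pow_two]
  ext : 1
  · funext q
    simp only [RegularWreathProduct.mul_left, hw, inv_one, one_mul, Pi.mul_apply]
    exact key _
  · simp [hw]

/-- The extension data of `G_k`: `H` is the image of `Y_k` and `Z` is the image of `R_k`. -/
theorem isCyclicExtension (k : ℕ) :
    IsCyclicExtension (x k) ((Y k).map (QuotientGroup.mk' (N k)))
      ((R k).map (QuotientGroup.mk' (N k))) where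
  normal := by
    have h1 : (B k).Normal := MonoidHom.normal_ker _
    have h2 : (Y k).Normal := Subgroup.Normal.comap h1 _
    exact h2.map _ (QuotientGroup.mk'_surjective _)
  le := Subgroup.map_mono (R_le_Y k)
  sup_eq := by
    rw [eq_top_iff, ← closure_eq_top k, Subgroup.closure_le]
    rintro g (rfl | rfl)
    · exact Subgroup.mem_sup_left (Subgroup.mem_zpowers _)
    · exact Subgroup.mem_sup_right (y_mem k)
  sq_mem := by
    rintro _ ⟨f, hf, rfl⟩
    exact ⟨f ^ 2, MonoidHom.mem_ker.2 (by rw [map_pow, sq_eq_one_of_mem_B hf]), rfl⟩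
  commutator_mem := by
    rintro _ ⟨f, hf, rfl⟩ _ ⟨g, hg, rfl⟩
    refine ⟨⁅f, g⁆, MonoidHom.mem_ker.2 ?_, rfl⟩
    rw [map_commutatorElement, commutatorElement_eq_one_iff_mul_comm]
    exact RegularWreathProduct.mul_comm_of_right_eq_one hf hg
  comm := by
    rintro _ ⟨f, hf, rfl⟩ _ ⟨g, hg, rfl⟩
    exact mk_comm hf hg
  sq_eq_one := by
    rintro _ ⟨f, hf, rfl⟩
    exact mk_sq hf

theorem sq_iterate_commutator_y_ne_one (k : ℕ) :
    ((fun v => ⁅x k, v⁆)^[2 ^ k - 1] (y k)) ^ 2 ≠ 1 := by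
  let θ : G k →* V k := QuotientGroup.lift (N k) (toV k) (N_le_ker k)
  have hx : θ (x k) = xV k := toV_a k
  have hy : θ (y k) = yV k := toV_b k
  have hit : θ ((fun v => ⁅x k, v⁆)^[2 ^ k - 1] (y k)) =
      (fun v => ⁅xV k, v⁆)^[2 ^ k - 1] (yV k) := by
    rw [← hy]
    exact Function.Semiconj.iterate_right (f := θ)
      (fun v => by rw [map_commutatorElement, hx]) _ _
  intro h
  apply sq_iterate_commutator_yV_ne_one k
  rw [← hit, ← map_pow, h, map_one]

/-- The square of the commutator `[x, …, [x, y]]` of weight `2 ^ k` lies in `D_{2 ^ (k + 1)}`, and its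
image in `V k` is not trivial. -/
theorem dimensionSeries_ne_bot (k : ℕ) : dimensionSeries 2 (G k) (2 ^ (k + 1)) ≠ ⊥ := by
  intro h
  have h1 : 1 ≤ 2 ^ k := Nat.one_le_two_pow
  have hy := y_mem k
  rw [← layer_one ((Y k).map _)] at hy
  have hl := (isCyclicExtension k).iterate_mem_layer (x k) (2 ^ k - 1) le_rfl hy
  rw [Nat.add_sub_cancel' h1] at hl
  have h2 : 2 ≤ 2 ^ (k + 1) := by rw [pow_succ]; omega
  have hc : 2 ^ (k + 1) ⌈/⌉ 2 = 2 ^ k := by rw [ceilDiv_two, pow_succ]; omega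
  have hD := powSubgroup_le_dimensionSeries (Γ := G k) h2
  rw [hc] at hD
  replace hD := hD (sq_mem_powSubgroup (gamma_le_dimensionSeries h1 hl.1))
  rw [h, Subgroup.mem_bot] at hD
  exact sq_iterate_commutator_y_ne_one k hD

end GroupG

/-! ### The dimension subgroup series of `G_k` -/

theorem mainTheorem5 (k : ℕ) (hk : 1 ≤ k) :
    GroupSeries.HasLength (GroupSeries.dimensionSeries 2 (GroupG.G k)) (2 ^ (k + 1)) ∧
      ∀ i : ℕ, 1 ≤ i → i ≤ 2 ^ (k + 1) →
        GroupSeries.dimensionSeries 2 (GroupG.G k) i =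
          Subgroup.zpowers (GroupG.x k ^ 2 ^ Nat.clog 2 i) ⊔
            GroupSeries.powSubgroup (GroupSeries.gamma (GroupG.G k) (i ⌈/⌉ 2)) 2 ⊔
            GroupSeries.gamma (GroupG.G k) i := by
  have h := GroupG.isCyclicExtension k
  refine ⟨⟨h.dimensionSeries_eq_bot (GroupG.x_pow k), fun n hn => ?_⟩,
    fun i hi _ => h.dimensionSeries_eq hi⟩
  by_contra! hlt
  refine GroupG.dimensionSeries_ne_bot k (eq_bot_iff.2 ?_)
  have hn : GroupSeries.dimensionSeries 2 (GroupG.G k) (n + 1) = ⊥ := hn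
  rw [← hn]
  exact GroupSeries.dimensionSeries_antitone hlt
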